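/- Let $C>0$, $\alpha\in(0,1]$ and $a,A,K>0$. There is a constant $c>0$, depending only on $C,\alpha,a,A,K$, such that the following holds. Let $(\mathcal M,d)$ be a complete, uniquely geodesic metric space (every two points $p,q$ are joined by exactly one geodesic $\gamma_p^q:[0,d(p,q)]\to\mathcal M$). For $u,q\ne p$ let $\angle_p(u,q)$ be the Alexandrov angle at $p$ between $\gamma_p^u$ and $\gamma_p^q$, that is $$\angle_p(u,q)=\lim_{r\downarrow0}\ \sup_{0<s,t<r}\ \arccos\frac{d^2(p,\gamma_p^u(s))+d^2(p,\gamma_p^q(t))-d^2(\gamma_p^u(s),\gamma_p^q(t))}{2\,d(p,\gamma_p^u(s))\,d(p,\gamma_p^q(t))}.$$ Assume that for all $p,q,r,u\in\mathcal M$ with $u\ne p$ $$\bigl|d(p,q)\cos\angle_p(u,q)-d(p,r)\cos\angle_p(u,r)\bigr|\le C\,d(q,r)^{\alpha},$$ where $d(p,q)\cos\angle_p(u,q)$ is read as $0$ if $q=p$. Let $X$ be a random element of $\mathcal M$ with law $P$ and Fréchet mean $\mu^*$ (a minimizer of $\mu\mapsto \mathbb E\,d^2(X,\mu)$), and suppose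 $0<\sigma_X^2=\mathbb E\,d^2(\mu^*,X)<\infty$. For $\beta\in\mathcal M$ put $h(\beta;x,\mu^*)=d(\mu^*,x)\,d(\mu^*,\beta)\cos\angle_{\mu^*}(x,\beta)$ (equal to $0$ if $x=\mu^*$ or $\beta=\mu^*$), assumed $P$-measurable in $x$. In the binary regression model with parameter $\beta$, the pair $(X,Y)\in\mathcal M\times\{0,1\}$ satisfies $X\sim P$ and $$\operatorname{logit}\,\mathbb P(Y=1\mid X)=h(\beta;X,\mu^*).$$ Let $(X_1,Y_1),\dots,(X_n,Y_n)$ be i.i.d. from this model, let $\mathbb E_\beta$ be the corresponding expectation, and let $$R_n=\inf_{\hat\beta_n}\ \sup_{\beta\in\mathcal M}\ \mathbb E_\beta\bigl[d^2(\beta,\hat\beta_n)\bigr]\in[0,\infty],$$ where the infimum is over all measurable estimators $\hat\beta_n=\hat\beta_n((X_1,Y_1),\dots,(X_n,Y_n))\in\mathcal M$. Let $\beta^*\in\mathcal M$ and $D>0$, let $B(\beta^*,\delta)$ be the closed ball of radius $\delta$ around $\beta^*$, and let $N(\epsilon,B(\beta^*,\delta))$ be the least number of closed balls of radius $\epsilon$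 with centers in $B(\beta^*,\delta)$ that cover $B(\beta^*,\delta)$. (a) If there is $\delta_0>0$ such that $N(\epsilon,B(\beta^*,\delta))$ is finite and $$a\Bigl(\frac\delta\epsilon\Bigr)^{D}\le N(\epsilon,B(\beta^*,\delta))\le A\Bigl(\frac\delta\epsilon\Bigr)^{D}\quad\text{for all }0<\delta\le\delta_0,\ \epsilon>0\text{ with }\delta/\epsilon\ge K,$$ then, for all sufficiently large $n$, $$R_n\ \ge\ c\left(\frac{D}{\sigma_X^2\,n}\right)^{1/\alpha}.$$ (b) If there is $\delta_0>0$ such that $N(\epsilon,B(\beta^*,\delta))$ is finite and $$a\Bigl(\frac\delta\epsilon\Bigr)^{D}\le \log N(\epsilon,B(\beta^*,\delta))\le A\Bigl(\frac\delta\epsilon\Bigr)^{D}\quad\text{for all }0<\delta\le\delta_0,\ \epsilon>0\text{ with }\delta/\epsilon\ge K,$$ then, for all sufficiently large $n$, $$R_n\ \ge\ c\left(\frac{1}{\sigma_X^2\,n}\right)^{1/\alpha}.$$ -/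

import Mathlib

open MeasureTheory Filter Topology
open scoped ENNReal NNReal

noncomputable section

namespace MetricBinaryRegression

/-- `γ`, restricted to `[0, d(p,q)]`, is a geodesic connecting `p` and `q`
(values of `γ` outside this interval play no role). -/
structure IsGeodesic {M : Type*} [MetricSpace M] (p q : M) (γ : ℝ → M) : Prop where
  source : γ 0 = p
  target : γ (dist p q) = q
  isometry : ∀ s ∈ Set.Icc 0 (dist p q), ∀ t ∈ Set.Icc 0 (dist p q),
    dist (γ s) (γ t) = |s - t|

/-- Every two points are connected by a geodesic, and this geodesic is unique. -/
def UniquelyGeodesic (M : Type*) [MetricSpace M] : Prop :=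
  ∀ p q : M, (∃ γ : ℝ → M, IsGeodesic p q γ) ∧
    ∀ γ η : ℝ → M, IsGeodesic p q γ → IsGeodesic p q η → Set.EqOn γ η (Set.Icc 0 (dist p q))

open Classical in
/-- The geodesic from `p` to `q`. In a uniquely geodesic space its restriction to `[0, d(p,q)]`
is the unique one; where no geodesic exists it is a constant map. -/
def geod {M : Type*} [MetricSpace M] (p q : M) : ℝ → M :=
  if h : ∃ γ : ℝ → M, IsGeodesic p q γ then h.choose else fun _ => p

/-- The comparison angle at `p` between `q` and `r` (for distinct points). -/
def comparisonAngle {M : Type*} [MetricSpace M] (p q r : M) : ℝ :=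
  Real.arccos ((dist p q ^ 2 + dist p r ^ 2 - dist q r ^ 2) / (2 * dist p q * dist p r))

/-- The Alexandrov angle at `p` between the geodesics from `p` to `q` and from `p` to `r`,
for `q ≠ p` and `r ≠ p`: the limit, as `ρ → 0`, of the supremum of the comparison angles
at `p` between `γ s` and `η t` over `0 < s, t < ρ`. -/
def alexAngle {M : Type*} [MetricSpace M] (p q r : M) : ℝ :=
  limsup (fun st : ℝ × ℝ => comparisonAngle p (geod p q st.1) (geod p r st.2))
    (𝓝[>] (0 : ℝ) ×ˢ 𝓝[>] (0 : ℝ))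

/-- The Alexandrov inner product
`h(β; x, μ) = d(μ, x) d(μ, β) cos ∠_μ(x, β)`; it is `0` if `x = μ` or `β = μ`. -/
def alexInner {M : Type*} [MetricSpace M] (β x μ : M) : ℝ :=
  dist μ x * dist μ β * Real.cos (alexAngle μ x β)

/-- The Hölder-type regularity of the projections `d(p, q) cos ∠_p(u, q)` in `q`. The angle at `p`
has no meaning for `u = p`; for `q = p` the projection is `0`. -/
def ProjectionHolder (M : Type*) [MetricSpace M] (C α : ℝ) : Prop :=
  ∀ p q r u : M, u ≠ p →
    |dist p q * Real.cos (alexAngle p u q) - dist p r * Real.cos (alexAngle p u r)|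
      ≤ C * dist q r ^ α

/-- `μ` minimizes `ν ↦ E d²(X, ν)`, where `X` has law `P`. -/
def IsFrechetMean {M : Type*} [MetricSpace M] [MeasurableSpace M] (P : Measure M) (μ : M) : Prop :=
  ∀ ν : M, ∫⁻ x, ENNReal.ofReal (dist x μ ^ 2) ∂P ≤ ∫⁻ x, ENNReal.ofReal (dist x ν ^ 2) ∂P

/-- `E d²(μ, X)`, where `X` has law `P`. -/
def variance {M : Type*} [MetricSpace M] [MeasurableSpace M] (P : Measure M) (μ : M) : ℝ :=
  ∫ x, dist μ x ^ 2 ∂P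

/-- The conditional probability of the response `y` (`true` stands for `1`, `false` for `0`) given
`X = x`, when the log odds of `y = 1` are `h(β; x, μ)`. -/
def responseProb {M : Type*} [MetricSpace M] (μ β x : M) (y : Bool) : ℝ :=
  if y then Real.sigmoid (alexInner β x μ) else 1 - Real.sigmoid (alexInner β x μ)

/-- The joint law of `(X, Y)` in the binary regression model: `X` has law `P`, and
`logit P(Y = 1 | X) = h(β; X, μ)`. -/
def modelLaw {M : Type*} [MetricSpace M] [MeasurableSpace M] (P : Measure M) (μ β : M) :
    Measure (M × Bool) :=
  (P.prod Measure.count).withDensity fun z => ENNReal.ofReal (responseProb μ β z.1 z.2)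

/-- The minimax risk for squared distance, from `n` independent observations of the model: the
infimum over all (measurable) estimators of the supremum over `β` of `E_β d²(β, b)`. -/
def minimaxRisk {M : Type*} [MetricSpace M] [MeasurableSpace M] (P : Measure M) (μ : M) (n : ℕ) :
    ℝ≥0∞ :=
  ⨅ (b : (Fin n → M × Bool) → M) (_ : Measurable b),
    ⨆ β : M, ∫⁻ z, ENNReal.ofReal (dist β (b z) ^ 2) ∂(Measure.pi fun _ : Fin n => modelLaw P μ β)

/-- The covering number of the closed ball of radius `δ` around `β` by closed balls of radius `ε`
with centers in it. -/
def localCovering {M : Type*} [MetricSpace M] (β : M) (δ ε : ℝ) : ℕ∞ :=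
  Metric.coveringNumber ε.toNNReal (Metric.closedBall β δ)

/-- `N(ε, B(β, δ)) ≍ (δ/ε)^D`, with constants `a` and `A`, for all small `δ` and all
`δ/ε ≥ K`. -/
def LogPolynomialEntropy {M : Type*} [MetricSpace M] (β : M) (D a A K : ℝ) : Prop :=
  ∃ δ₀ > 0, ∀ δ ε : ℝ, 0 < δ → δ ≤ δ₀ → 0 < ε → K ≤ δ / ε →
    localCovering β δ ε ≠ ⊤ ∧
    a * (δ / ε) ^ D ≤ ((localCovering β δ ε).toNat : ℝ) ∧
    ((localCovering β δ ε).toNat : ℝ) ≤ A * (δ / ε) ^ D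

/-- `log N(ε, B(β, δ)) ≍ (δ/ε)^D`, with constants `a` and `A`, for all small `δ` and all
`δ/ε ≥ K`. -/
def PolynomialEntropy {M : Type*} [MetricSpace M] (β : M) (D a A K : ℝ) : Prop :=
  ∃ δ₀ > 0, ∀ δ ε : ℝ, 0 < δ → δ ≤ δ₀ → 0 < ε → K ≤ δ / ε →
    localCovering β δ ε ≠ ⊤ ∧
    a * (δ / ε) ^ D ≤ Real.log ((localCovering β δ ε).toNat : ℝ) ∧
    Real.log ((localCovering β δ ε).toNat : ℝ) ≤ A * (δ / ε) ^ D

end MetricBinaryRegression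

end

open MetricBinaryRegression

namespace MetricBinaryRegression

/-! The proof is Fano's method on a finite family of parameters. The Kullback-Leibler divergence of
two Bernoulli laws is at most the squared difference of their logits (`bernoulli_kl_le`). By the
Hölder condition on projections, parameters at distance at most `ρ` have logits differing by at most
`C * ρ ^ α * dist μ x`, so `n` observations carry divergence at most `n * C ^ 2 * ρ ^ (2 * α) *
variance P μ`. If this is at most a quarter of the logarithm of the size of an `ε`-separated family
of diameter at most `ρ`, no estimator identifies the parameter reliably, and the risk is at least `ε
^ 2 / 8` (`exists_half_le_measureReal_compl`, `le_minimaxRisk`).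

Two families suffice. Sixteen points on a geodesic give the parametric rate, which is the rate in
(b) and, up to a constant, in (a) when `D` is bounded. For large `D` in (a), a separated set in a
small ball has at least `exp D` points at a fixed ratio of `ρ` to `ε`, which yields the factor `D`.
-/

/-! ### Sigmoid estimates and the divergence of Bernoulli laws. -/

lemma abs_sigmoid_sub_le (a b : ℝ) : |Real.sigmoid a - Real.sigmoid b| ≤ |a - b| := by
  have h : LipschitzWith 1 Real.sigmoid := by
    refine lipschitzWith_of_nnnorm_deriv_le differentiable_sigmoid fun x => ?_
    rw [← NNReal.coe_le_coe, coe_nnnorm, Real.deriv_sigmoid, Real.norm_eq_abs, abs_le]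
    have h0 := Real.sigmoid_pos x
    have h1 := Real.sigmoid_lt_one x
    constructor <;> simp only [NNReal.coe_one] <;> nlinarith
  simpa [Real.dist_eq] using h.dist_le_mul a b

lemma log_sigmoid_sub_log_sigmoid_neg (a : ℝ) :
    Real.log (Real.sigmoid a) - Real.log (Real.sigmoid (-a)) = a := by
  rw [← Real.sigmoid_mul_rexp_neg, Real.log_mul (Real.sigmoid_pos a).ne' (Real.exp_pos _).ne',
    Real.log_exp]
  ring

lemma abs_log_sigmoid_sub_le (a b : ℝ) :
    |Real.log (Real.sigmoid a) - Real.log (Real.sigmoid b)| ≤ |a - b| := by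
  have h : LipschitzWith 1 fun x => Real.log (Real.sigmoid x) := by
    have hd (x : ℝ) := (Real.hasDerivAt_sigmoid x).log (Real.sigmoid_pos x).ne'
    refine lipschitzWith_of_nnnorm_deriv_le (fun x => (hd x).differentiableAt) fun x => ?_
    rw [← NNReal.coe_le_coe, coe_nnnorm, (hd x).deriv, Real.norm_eq_abs,
      mul_div_cancel_left₀ _ (Real.sigmoid_pos x).ne', abs_le]
    have h0 := Real.sigmoid_pos x
    have h1 := Real.sigmoid_lt_one x
    constructor <;> simp only [NNReal.coe_one] <;> linarith
  simpa [Real.dist_eq] using h.dist_le_mul a b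

/-- The Kullback-Leibler divergence of two Bernoulli laws is nonnegative (logit form). -/
lemma bernoulli_kl_nonneg (a b : ℝ) :
    0 ≤ Real.sigmoid a * (Real.log (Real.sigmoid a) - Real.log (Real.sigmoid b)) +
      Real.sigmoid (-a) * (Real.log (Real.sigmoid (-a)) - Real.log (Real.sigmoid (-b))) := by
  -- From `log t ≤ t - 1` at `t = sigmoid b / sigmoid a`. The lower bounds for the two responses
  -- cancel, as the probabilities sum to one.
  have key (a b : ℝ) : Real.sigmoid a - Real.sigmoid b ≤
      Real.sigmoid a * (Real.log (Real.sigmoid a) - Real.log (Real.sigmoid b)) := by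
    have ha := Real.sigmoid_pos a
    have hb := Real.sigmoid_pos b
    have h := Real.log_le_sub_one_of_pos (div_pos hb ha)
    rw [Real.log_div hb.ne' ha.ne'] at h
    have h2 := mul_le_mul_of_nonneg_left h ha.le
    rw [mul_sub, mul_sub, mul_div_cancel₀ _ ha.ne'] at h2
    linarith
  have h1 := key a b
  have h2 := key (-a) (-b)
  rw [Real.sigmoid_neg a, Real.sigmoid_neg b] at *
  linarith

/-- The Kullback-Leibler divergence of two Bernoulli laws is at most the squared difference of
their logits. -/
lemma bernoulli_kl_le (a b : ℝ) :
    Real.sigmoid a * (Real.log (Real.sigmoid a) - Real.log (Real.sigmoid b)) +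
      Real.sigmoid (-a) * (Real.log (Real.sigmoid (-a)) - Real.log (Real.sigmoid (-b)))
      ≤ (a - b) ^ 2 := by
  -- Adding the nonnegative reverse divergence gives the symmetrized one, which equals `(sigmoid a -
  -- sigmoid b) * (a - b)`.
  have h := bernoulli_kl_nonneg b a
  have ha := log_sigmoid_sub_log_sigmoid_neg a
  have hb := log_sigmoid_sub_log_sigmoid_neg b
  have hs : (Real.sigmoid a - Real.sigmoid b) * (a - b) ≤ (a - b) ^ 2 := by
    calc _ ≤ |Real.sigmoid a - Real.sigmoid b| * |a - b| := by
          rw [← abs_mul]; exact le_abs_self _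
      _ ≤ |a - b| * |a - b| :=
          mul_le_mul_of_nonneg_right (abs_sigmoid_sub_le a b) (abs_nonneg _)
      _ = _ := by rw [abs_mul_abs_self, sq]
  generalize Real.log (Real.sigmoid (-a)) = u at *
  generalize Real.log (Real.sigmoid (-b)) = v at *
  rw [Real.sigmoid_neg a, Real.sigmoid_neg b] at *
  rw [sub_eq_iff_eq_add.1 ha, sub_eq_iff_eq_add.1 hb] at *
  linarith

/-! ### Change of measure and Fano's inequality for logistic laws. -/

section Logistic

variable {X : Type*} [MeasurableSpace X]

/-- A weak Donsker-Varadhan inequality for the indicator of a set. -/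
lemma mul_measureReal_le_integral_add_log {μ ν : Measure X} [IsProbabilityMeasure μ]
    [IsProbabilityMeasure ν] {L : X → ℝ} (hLm : Measurable L) (hL : Integrable L μ)
    (hν : ν = μ.withDensity fun z => ENNReal.ofReal (Real.exp (-L z)))
    {A : Set X} (hA : MeasurableSet A) {s : ℝ} (hs : 0 ≤ s) :
    s * μ.real A ≤ ∫ z, L z ∂μ + Real.log (1 + (Real.exp s - 1) * ν.real A) := by
  -- `Z` is the `ν`-integral of `exp (s * 1_A)`, so `exp (s * 1_A - L) / Z` has `μ`-integral one.
  -- The claim is the `μ`-integral of `x + 1 ≤ exp x` at `x = s * 1_A - L - log Z`.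
  set Z := 1 + (Real.exp s - 1) * ν.real A with hZ
  have hs1 : 0 ≤ Real.exp s - 1 := by linarith [Real.one_le_exp hs]
  have hZ1 : 0 < Z := by positivity
  have hint : Integrable (fun z => 1 + A.indicator (fun _ => Real.exp s - 1) z) ν :=
    (integrable_const _).add ((integrable_const _).indicator hA)
  have hval : ∫ z, (1 + A.indicator (fun _ => Real.exp s - 1) z) ∂ν = Z := by
    rw [integral_add (integrable_const _) ((integrable_const _).indicator hA),
      integral_indicator_const _ hA]
    simp [hZ, mul_comm]
  have hmeas : Measurable fun z => ENNReal.ofReal (Real.exp (-L z)) := by fun_prop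
  have hfin : ∀ᵐ z ∂μ, ENNReal.ofReal (Real.exp (-L z)) < ∞ := by simp
  rw [hν, integral_withDensity_eq_integral_toReal_smul hmeas hfin] at hval
  rw [hν, integrable_withDensity_iff_integrable_smul' hmeas hfin] at hint
  have hind : Integrable (A.indicator fun _ => s) μ := (integrable_const s).indicator hA
  have hlhs : ∫ z, (A.indicator (fun _ => s) z - L z - Real.log Z) ∂μ
      = s * μ.real A - ∫ z, L z ∂μ - Real.log Z := by
    rw [integral_sub (f := fun z => A.indicator (fun _ => s) z - L z) (hind.sub hL)
      (integrable_const _), integral_sub hind hL,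
      integral_indicator_const _ hA]
    simp [mul_comm]
  have hrhs : ∫ z, ((ENNReal.ofReal (Real.exp (-L z))).toReal •
      (1 + A.indicator (fun _ => Real.exp s - 1) z) / Z - 1) ∂μ = 0 := by
    rw [integral_sub (hint.div_const Z) (integrable_const _), integral_div, hval]
    simp [hZ1.ne']
  have hle := integral_mono ((hind.sub hL).sub (integrable_const (Real.log Z)))
    ((hint.div_const Z).sub (integrable_const (1 : ℝ))) fun z => by
      change A.indicator (fun _ => s) z - L z - Real.log Z ≤
        (ENNReal.ofReal (Real.exp (-L z))).toReal •
          (1 + A.indicator (fun _ => Real.exp s - 1) z) / Z - 1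
      have h := Real.add_one_le_exp (A.indicator (fun _ => s) z - L z - Real.log Z)
      rw [Real.exp_sub, Real.exp_sub, Real.exp_log hZ1] at h
      rw [ENNReal.toReal_ofReal (Real.exp_pos _).le, Real.exp_neg, smul_eq_mul]
      have : 1 + A.indicator (fun _ => Real.exp s - 1) z =
          Real.exp (A.indicator (fun _ => s) z) := by
        by_cases hz : z ∈ A <;> simp [hz]
      rw [this, inv_mul_eq_div]
      linarith
  have hle' := hlhs.symm.trans_le (hle.trans_eq hrhs)
  linarith

/-- Densities multiply in finite products. -/
lemma pi_withDensity {n : ℕ} {μ ν : Measure X} [IsProbabilityMeasure μ] [IsProbabilityMeasure ν]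
    {f : X → ℝ≥0∞} (hf : Measurable f) (hν : ν = μ.withDensity f) :
    Measure.pi (fun _ : Fin n => ν) =
      (Measure.pi fun _ : Fin n => μ).withDensity fun z => ∏ k, f (z k) := by
  refine Measure.pi_eq fun s hs => ?_
  rw [withDensity_apply _ (MeasurableSet.univ_pi hs),
    ← lintegral_indicator (MeasurableSet.univ_pi hs)]
  have h1 : (Set.univ.pi s).indicator (fun z : Fin n → X => ∏ k, f (z k)) =
      fun z => ∏ k, (s k).indicator f (z k) := by
    ext z
    by_cases hz : z ∈ Set.univ.pi s
    · rw [Set.indicator_of_mem hz]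
      exact Finset.prod_congr rfl fun k _ => (Set.indicator_of_mem (hz k trivial) f).symm
    · rw [Set.indicator_of_notMem hz]
      simp only [Set.mem_pi, Set.mem_univ, true_imp_iff, not_forall] at hz
      obtain ⟨k, hk⟩ := hz
      exact (Finset.prod_eq_zero (Finset.mem_univ k) (Set.indicator_of_notMem hk f)).symm
  rw [h1]
  have hm (k : Fin n) : Measurable ((s k).indicator f) := hf.indicator (hs k)
  -- On a box the integrand is a product of functions of single coordinates, which are independent
  -- under the product measure.
  have hind := ProbabilityTheory.iIndepFun_pi (μ := fun _ : Fin n => μ)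
    (X := fun k => (s k).indicator f) fun k => (hm k).aemeasurable
  have h2 := ProbabilityTheory.lintegral_prod_eq_prod_lintegral_of_indepFun Finset.univ _ hind
    fun k => (hm k).comp (measurable_pi_apply k)
  rw [h2]
  refine Finset.prod_congr rfl fun k _ => ?_
  rw [(measurePreserving_eval (fun _ : Fin n => μ) k).lintegral_comp (hm k), hν,
    withDensity_apply _ (hs k), lintegral_indicator (hs k)]

/-- The signed logit: `t` for the response `true` and `-t` for the response `false`. -/
def signedLogit (t : ℝ) (y : Bool) : ℝ := if y then t else -t

lemma measurable_signedLogit {h : X → ℝ} (hh : Measurable h) :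
    Measurable fun z : X × Bool => signedLogit (h z.1) z.2 := by
  refine measurable_from_prod_countable_left fun y => ?_
  cases y <;> simp only [signedLogit] <;> simpa using by fun_prop

/-- The joint law of a covariate with law `P` and a binary response with log odds `h`. -/
noncomputable def logisticLaw (P : Measure X) (h : X → ℝ) : Measure (X × Bool) :=
  (P.prod Measure.count).withDensity
    fun z => ENNReal.ofReal (Real.sigmoid (signedLogit (h z.1) z.2))

/-- The log-likelihood ratio of two logistic laws. -/
noncomputable def logisticLLR (f g : X → ℝ) (z : X × Bool) : ℝ :=
  Real.log (Real.sigmoid (signedLogit (f z.1) z.2)) -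
    Real.log (Real.sigmoid (signedLogit (g z.1) z.2))

lemma measurable_sigmoid_signedLogit {h : X → ℝ} (hh : Measurable h) :
    Measurable fun z : X × Bool => Real.sigmoid (signedLogit (h z.1) z.2) :=
  continuous_sigmoid.measurable.comp (measurable_signedLogit hh)

lemma measurable_logisticLLR {f g : X → ℝ} (hf : Measurable f) (hg : Measurable g) :
    Measurable (logisticLLR f g) :=
  (measurable_sigmoid_signedLogit hf).log.sub (measurable_sigmoid_signedLogit hg).log

lemma logisticLaw_eq_withDensity {P : Measure X} [SFinite P] {f g : X → ℝ}
    (hf : Measurable f) (hg : Measurable g) :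
    logisticLaw P g =
      (logisticLaw P f).withDensity fun z => ENNReal.ofReal (Real.exp (-logisticLLR f g z)) := by
  have hm : Measurable fun z => ENNReal.ofReal (Real.exp (-logisticLLR f g z)) :=
    (measurable_logisticLLR hf hg).neg.exp.ennreal_ofReal
  rw [logisticLaw, logisticLaw, ← withDensity_mul _
    (measurable_sigmoid_signedLogit hf).ennreal_ofReal hm]
  congr 1
  ext z
  have h1 := Real.sigmoid_pos (signedLogit (f z.1) z.2)
  have h2 := Real.sigmoid_pos (signedLogit (g z.1) z.2)
  rw [Pi.mul_apply, ← ENNReal.ofReal_mul h1.le, logisticLLR, neg_sub, Real.exp_sub,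
    Real.exp_log h1, Real.exp_log h2, mul_div_cancel₀ _ h1.ne']

lemma abs_logisticLLR_le {X : Type*} (f g : X → ℝ) (z : X × Bool) :
    |logisticLLR f g z| ≤ |f z.1 - g z.1| := by
  refine (abs_log_sigmoid_sub_le _ _).trans_eq ?_
  rcases z with ⟨x, _ | _⟩
  · simp only [signedLogit, Bool.false_eq_true, if_false]
    rw [← abs_neg]; congr 1; ring
  · simp [signedLogit]

variable {P : Measure X} [IsProbabilityMeasure P]

lemma isProbabilityMeasure_logisticLaw {h : X → ℝ} (hh : Measurable h) :
    IsProbabilityMeasure (logisticLaw P h) := by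
  constructor
  have hm := (measurable_sigmoid_signedLogit hh).ennreal_ofReal
  rw [logisticLaw, withDensity_apply _ MeasurableSet.univ, Measure.restrict_univ,
    lintegral_prod _ hm.aemeasurable]
  have (x : X) : ∫⁻ y, ENNReal.ofReal (Real.sigmoid (signedLogit (h x) y)) ∂Measure.count = 1 := by
    rw [lintegral_count, tsum_bool, ← ENNReal.ofReal_add (Real.sigmoid_nonneg _)
      (Real.sigmoid_nonneg _)]
    simp [signedLogit, Real.sigmoid_neg]
  simp [this]

lemma integrable_smul_logisticLLR {f g : X → ℝ} (hf : Measurable f) (hg : Measurable g)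
    (hfg : Integrable (fun x => (f x - g x) ^ 2) P) :
    Integrable (fun z => (ENNReal.ofReal (Real.sigmoid (signedLogit (f z.1) z.2))).toReal •
      logisticLLR f g z) (P.prod Measure.count) := by
  have h1 : Integrable (fun x => 1 + (f x - g x) ^ 2) P := (integrable_const 1).add hfg
  refine Integrable.mono' (h1.comp_fst Measure.count) ?_ (.of_forall fun z => ?_)
  · exact ((measurable_sigmoid_signedLogit hf).ennreal_ofReal.ennreal_toReal.smul
      (measurable_logisticLLR hf hg)).aestronglyMeasurable
  · rw [ENNReal.toReal_ofReal (Real.sigmoid_nonneg _), smul_eq_mul, Real.norm_eq_abs, abs_mul,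
      abs_of_nonneg (Real.sigmoid_nonneg _)]
    have h2 := abs_logisticLLR_le f g z
    have h3 := Real.sigmoid_le_one (signedLogit (f z.1) z.2)
    have h4 := mul_le_mul h3 h2 (abs_nonneg _) zero_le_one
    -- This gives `2 * |x| ≤ 1 + x ^ 2`, so square integrability of the logit difference suffices.
    have h5 := sq_nonneg (|f z.1 - g z.1| - 1)
    have h6 := sq_abs (f z.1 - g z.1)
    nlinarith

lemma integrable_logisticLLR {f g : X → ℝ} (hf : Measurable f) (hg : Measurable g)
    (hfg : Integrable (fun x => (f x - g x) ^ 2) P) :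
    Integrable (logisticLLR f g) (logisticLaw P f) := by
  rw [logisticLaw, integrable_withDensity_iff_integrable_smul'
    (measurable_sigmoid_signedLogit hf).ennreal_ofReal (by simp)]
  exact integrable_smul_logisticLLR hf hg hfg

lemma integral_logisticLLR_le {f g : X → ℝ} (hf : Measurable f) (hg : Measurable g)
    (hfg : Integrable (fun x => (f x - g x) ^ 2) P) :
    ∫ z, logisticLLR f g z ∂(logisticLaw P f) ≤ ∫ x, (f x - g x) ^ 2 ∂P := by
  have hi := integrable_smul_logisticLLR hf hg hfg
  rw [logisticLaw, integral_withDensity_eq_integral_toReal_smul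
    (measurable_sigmoid_signedLogit hf).ennreal_ofReal (by simp), integral_prod _ hi]
  refine integral_mono hi.integral_prod_left hfg fun x => ?_
  have hsum : ∫ y, (ENNReal.ofReal (Real.sigmoid (signedLogit (f x) y))).toReal •
      logisticLLR f g (x, y) ∂Measure.count = ∑ y : Bool,
        Real.sigmoid (signedLogit (f x) y) * logisticLLR f g (x, y) := by
    rw [integral_fintype .of_finite]
    simp [ENNReal.toReal_ofReal, Real.sigmoid_nonneg]
  refine hsum.trans_le ?_
  rw [Fintype.sum_bool]
  exact bernoulli_kl_le (f x) (g x)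

/-- Data processing for `n` independent observations of two logistic laws and the indicator of an
event. -/
lemma mul_measureReal_pi_logisticLaw_le {f g : X → ℝ} (hf : Measurable f) (hg : Measurable g)
    (hfg : Integrable (fun x => (f x - g x) ^ 2) P) (n : ℕ) {A : Set (Fin n → X × Bool)}
    (hA : MeasurableSet A) {s : ℝ} (hs : 0 ≤ s) :
    s * (Measure.pi fun _ : Fin n => logisticLaw P f).real A ≤
      n * ∫ x, (f x - g x) ^ 2 ∂P +
        Real.log (1 + (Real.exp s - 1) * (Measure.pi fun _ : Fin n => logisticLaw P g).real A) := by
  have := isProbabilityMeasure_logisticLaw (P := P) hf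
  have := isProbabilityMeasure_logisticLaw (P := P) hg
  have hmp (k : Fin n) := measurePreserving_eval (fun _ : Fin n => logisticLaw P f) k
  have hlm := measurable_logisticLLR hf hg
  have hli := integrable_logisticLLR hf hg hfg
  have hcomp (k : Fin n) : Integrable (fun z : Fin n → X × Bool => logisticLLR f g (z k))
      (Measure.pi fun _ : Fin n => logisticLaw P f) :=
    ((hmp k).integrable_comp hli.aestronglyMeasurable).2 hli
  have hdens := pi_withDensity (n := n) (hlm.neg.exp.ennreal_ofReal)
    (logisticLaw_eq_withDensity (P := P) hf hg)
  have hprod (z : Fin n → X × Bool) : ∏ k, ENNReal.ofReal (Real.exp (-logisticLLR f g (z k))) =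
      ENNReal.ofReal (Real.exp (-∑ k, logisticLLR f g (z k))) := by
    rw [← ENNReal.ofReal_prod_of_nonneg fun _ _ => (Real.exp_pos _).le, ← Real.exp_sum,
      Finset.sum_neg_distrib]
  simp only [Pi.neg_apply, hprod] at hdens
  refine (mul_measureReal_le_integral_add_log
    (L := fun z : Fin n → X × Bool => ∑ k, logisticLLR f g (z k)) ?_ ?_ hdens hA hs).trans ?_
  · exact Finset.measurable_sum _ fun k _ => hlm.comp (measurable_pi_apply k)
  · exact integrable_finsetSum _ fun k _ => hcomp k
  · gcongr
    rw [integral_finsetSum _ fun k _ => hcomp k]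
    have hk (k : Fin n) : ∫ z, logisticLLR f g (z k) ∂(Measure.pi fun _ => logisticLaw P f) =
        ∫ z, logisticLLR f g z ∂(logisticLaw P f) := by
      conv_rhs => rw [← (hmp k).map_eq, integral_map (hmp k).measurable.aemeasurable
        hlm.aestronglyMeasurable]
    simp only [hk, Finset.sum_const, Finset.card_univ, Fintype.card_fin, nsmul_eq_mul]
    gcongr
    exact integral_logisticLLR_le hf hg hfg

/-- Fano's inequality: with many hypotheses that are close to each other, some hypothesis is missed
with probability at least one half. -/
lemma exists_half_le_measureReal_compl {ι : Type*} [Fintype ι] (hcard : 16 ≤ Fintype.card ι)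
    {h : ι → X → ℝ} (hm : ∀ i, Measurable (h i))
    (hint : ∀ i j, Integrable (fun x => (h i x - h j x) ^ 2) P) (n : ℕ)
    (hle : ∀ i j, n * ∫ x, (h i x - h j x) ^ 2 ∂P ≤ Real.log (Fintype.card ι) / 4)
    {A : ι → Set (Fin n → X × Bool)} (hA : ∀ i, MeasurableSet (A i))
    (hdisj : Pairwise fun i j => Disjoint (A i) (A j)) :
    ∃ i, 1 / 2 ≤ (Measure.pi fun _ : Fin n => logisticLaw P (h i)).real (A i)ᶜ := by
  have hprob (i : ι) := isProbabilityMeasure_logisticLaw (P := P) (hm i)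
  have hm16 : (16 : ℝ) ≤ Fintype.card ι := by exact_mod_cast hcard
  have hm0 : (0 : ℝ) < Fintype.card ι := by linarith
  have hne : Nonempty ι := Fintype.card_pos_iff.1 (by omega)
  obtain ⟨j⟩ := hne
  -- Disjoint events have total probability at most one under the reference law `j`, so one of them
  -- is unlikely there.
  obtain ⟨i, hi⟩ : ∃ i, (Measure.pi fun _ : Fin n => logisticLaw P (h j)).real (A i) ≤
      1 / Fintype.card ι := by
    by_contra! hlt
    have h1 := Finset.sum_lt_sum_of_nonempty ⟨j, Finset.mem_univ j⟩ fun i _ => hlt i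
    have h2 : ∑ i, (Measure.pi fun _ : Fin n => logisticLaw P (h j)).real (A i) ≤ 1 := by
      rw [← measureReal_biUnion_finset (fun a _ b _ hab => hdisj hab) fun i _ => hA i]
      exact measureReal_le_one
    simp [hm0.ne'] at h1
    linarith
  refine ⟨i, ?_⟩
  have hlog16 : 4 * Real.log 2 ≤ Real.log (Fintype.card ι) := by
    rw [← Real.log_rpow two_pos]
    exact Real.log_le_log (by norm_num) (by norm_num; exact hcard)
  have hlog2 := Real.log_pos one_lt_two
  -- With `m` hypotheses and `s = log m`, the last term is at most `log (1 + (m - 1) / m) ≤ log 2 ≤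
  -- (log m) / 4`; here `m ≥ 16` is needed. With the divergence the total is at most `(log m) / 2`.
  have key := mul_measureReal_pi_logisticLaw_le (hm i) (hm j) (hint i j) n (hA i)
    (s := Real.log (Fintype.card ι)) (by linarith)
  rw [Real.exp_log hm0] at key
  have hlog : Real.log (1 + (Fintype.card ι - 1) *
      (Measure.pi fun _ : Fin n => logisticLaw P (h j)).real (A i)) ≤ Real.log 2 := by
    have h0 : 0 ≤ (Measure.pi fun _ : Fin n => logisticLaw P (h j)).real (A i) :=
      measureReal_nonneg
    refine Real.log_le_log (by nlinarith) ?_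
    rw [le_div_iff₀ hm0] at hi
    nlinarith
  have hij := hle i j
  rw [probReal_compl_eq_one_sub (hA i)]
  by_contra! hlt
  nlinarith

end Logistic

/-! ### From separated parameters to the minimax risk. -/

section Minimax

variable {M : Type*} [MetricSpace M] [MeasurableSpace M] {P : Measure M}

/-- Logits are only almost everywhere measurable; altering them on a `P`-null set leaves the joint
law unchanged, so measurable versions may be used. -/
lemma modelLaw_eq_logisticLaw [SFinite P] {μ β : M}
    {h : M → ℝ} (hh : (fun x => alexInner β x μ) =ᵐ[P] h) :
    modelLaw P μ β = logisticLaw P h := by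
  refine withDensity_congr_ae ?_
  have h1 : ∀ᵐ z ∂(P.prod (Measure.count : Measure Bool)), alexInner β z.1 μ = h z.1 :=
    Measure.quasiMeasurePreserving_fst.ae hh
  filter_upwards [h1] with z hz
  rcases z with ⟨x, _ | _⟩ <;> simp_all [responseProb, signedLogit, Real.sigmoid_neg]

lemma abs_alexInner_sub_le {M : Type*} [MetricSpace M] {C α : ℝ}
    (hproj : ProjectionHolder M C α) (μ β β' x : M) :
    |alexInner β x μ - alexInner β' x μ| ≤ dist μ x * (C * dist β β' ^ α) := by
  -- The projection bound excludes `x = μ`, where both inner products vanish.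
  rcases eq_or_ne x μ with rfl | hx
  · simp [alexInner]
  · have h := hproj μ β β' x hx
    simp only [alexInner, mul_assoc, ← mul_sub]
    rw [abs_mul, abs_of_nonneg dist_nonneg]
    gcongr

/-- A lower bound on the minimax risk from a separated family of parameters in a small set. -/
lemma le_minimaxRisk [BorelSpace M] [IsProbabilityMeasure P] {C α : ℝ} (hC : 0 ≤ C) (hα : 0 ≤ α)
    (hproj : ProjectionHolder M C α) {μ : M} (hint : Integrable (fun x => dist μ x ^ 2) P)
    (hmeas : ∀ β : M, AEMeasurable (fun x => alexInner β x μ) P)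
    {ι : Type*} [Fintype ι] (hcard : 16 ≤ Fintype.card ι) {β : ι → M} {ε ρ : ℝ} (hε : 0 ≤ ε)
    (hsep : Pairwise fun i j => ε ≤ dist (β i) (β j)) (hdiam : ∀ i j, dist (β i) (β j) ≤ ρ)
    {n : ℕ} (hn : n * ((C * ρ ^ α) ^ 2 * variance P μ) ≤ Real.log (Fintype.card ι) / 4) :
    ENNReal.ofReal (ε ^ 2 / 8) ≤ minimaxRisk P μ n := by
  refine le_iInf₂ fun b hb => ?_
  set h : ι → M → ℝ := fun i => (hmeas (β i)).mk _ with hh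
  have hm (i : ι) : Measurable (h i) := (hmeas (β i)).measurable_mk
  have hae (i : ι) : (fun x => alexInner (β i) x μ) =ᵐ[P] h i := (hmeas (β i)).ae_eq_mk
  have hbd (i j : ι) : ∀ᵐ x ∂P, (h i x - h j x) ^ 2 ≤ (C * ρ ^ α) ^ 2 * dist μ x ^ 2 := by
    filter_upwards [hae i, hae j] with x hi hj
    rw [← hi, ← hj, ← mul_pow, mul_comm, ← sq_abs]
    refine pow_le_pow_left₀ (abs_nonneg _) ((abs_alexInner_sub_le hproj μ _ _ x).trans ?_) 2
    have := Real.rpow_le_rpow dist_nonneg (hdiam i j) hα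
    gcongr
  have hint' (i j : ι) : Integrable (fun x => (h i x - h j x) ^ 2) P := by
    refine (hint.const_mul ((C * ρ ^ α) ^ 2)).mono'
      (((hm i).sub (hm j)).pow_const 2).aestronglyMeasurable ?_
    filter_upwards [hbd i j] with x hx
    rwa [Real.norm_of_nonneg (sq_nonneg _)]
  have hle (i j : ι) : n * ∫ x, (h i x - h j x) ^ 2 ∂P ≤ Real.log (Fintype.card ι) / 4 := by
    refine le_trans ?_ hn
    rw [variance, ← integral_const_mul ((C * ρ ^ α) ^ 2)]
    exact mul_le_mul_of_nonneg_left
      (integral_mono_ae (hint' i j) (hint.const_mul _) (hbd i j)) n.cast_nonneg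
  have hdm (i : ι) : Measurable fun z => dist (β i) (b z) :=
    ((continuous_const.dist continuous_id).measurable).comp hb
  -- Balls of radius `ε / 2` around separated parameters are disjoint. Missing one with probability
  -- at least `1 / 2` costs at least `(ε / 2) ^ 2 / 2`.
  obtain ⟨i, hi⟩ := exists_half_le_measureReal_compl hcard hm hint' n hle
    (A := fun i => {z | dist (β i) (b z) < ε / 2})
    (fun i => measurableSet_lt (hdm i) measurable_const) (by
      intro i j hij
      refine Set.disjoint_left.2 fun z (hzi : dist _ _ < _) (hzj : dist _ _ < _) => ?_
      have h1 := dist_triangle_right (β i) (β j) (b z)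
      have h2 := hsep hij
      linarith)
  refine le_iSup_of_le (β i) ?_
  have hprob := isProbabilityMeasure_logisticLaw (P := P) (hm i)
  simp only [modelLaw_eq_logisticLaw (hae i)]
  set Q := Measure.pi fun _ : Fin n => logisticLaw P (h i)
  have hA : MeasurableSet {z : Fin n → M × Bool | dist (β i) (b z) < ε / 2}ᶜ :=
    (measurableSet_lt (hdm i) measurable_const).compl
  calc ENNReal.ofReal (ε ^ 2 / 8)
      ≤ ENNReal.ofReal ((ε / 2) ^ 2) * Q {z | dist (β i) (b z) < ε / 2}ᶜ := by
        rw [← ofReal_measureReal, ← ENNReal.ofReal_mul (sq_nonneg _)]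
        refine ENNReal.ofReal_le_ofReal ?_
        nlinarith [sq_nonneg ε]
    _ = ∫⁻ _ in {z | dist (β i) (b z) < ε / 2}ᶜ, ENNReal.ofReal ((ε / 2) ^ 2) ∂Q := by
        rw [setLIntegral_const]
    _ ≤ ∫⁻ z in {z | dist (β i) (b z) < ε / 2}ᶜ, ENNReal.ofReal (dist (β i) (b z) ^ 2) ∂Q := by
        refine setLIntegral_mono' hA fun z hz => ENNReal.ofReal_le_ofReal ?_
        have : ε / 2 ≤ dist (β i) (b z) := not_lt.1 hz
        gcongr
    _ ≤ _ := setLIntegral_le_lintegral _ _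

end Minimax

/-! ### Separated families from geodesics and from covering numbers. -/

section Families

variable {M : Type*} [MetricSpace M]

/-- Equally spaced points on a geodesic. -/
lemma exists_equispaced (hM : UniquelyGeodesic M) {p q : M} {δ : ℝ} (hδ : 0 ≤ δ)
    (hpq : δ ≤ dist p q) {m : ℕ} (hm : 0 < m) :
    ∃ β : Fin m → M, (Pairwise fun i j => δ / m ≤ dist (β i) (β j)) ∧
      ∀ i j, dist (β i) (β j) ≤ δ := by
  obtain ⟨⟨γ, hγ⟩, -⟩ := hM p q
  have hm' : (0 : ℝ) < m := by exact_mod_cast hm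
  have hmem (i : Fin m) : (i : ℝ) * (δ / m) ∈ Set.Icc 0 δ := by
    have hi : (i : ℝ) ≤ m := by exact_mod_cast i.2.le
    refine ⟨by positivity, ?_⟩
    calc (i : ℝ) * (δ / m) ≤ m * (δ / m) := by gcongr
      _ = δ := by field_simp
  have hdist (i j : Fin m) : dist (γ (i * (δ / m))) (γ (j * (δ / m))) =
      |(i : ℝ) * (δ / m) - j * (δ / m)| :=
    hγ.isometry _ (Set.Icc_subset_Icc_right hpq (hmem i)) _ (Set.Icc_subset_Icc_right hpq (hmem j))
  refine ⟨fun i => γ (i * (δ / m)), fun i j hij => ?_, fun i j => ?_⟩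
  · change _ ≤ dist (γ _) (γ _)
    rw [hdist, ← sub_mul, abs_mul, abs_of_nonneg (by positivity : 0 ≤ δ / m)]
    refine le_mul_of_one_le_left (by positivity) ?_
    have : (1 : ℤ) ≤ |(i : ℤ) - j| := Int.one_le_abs (by
      rw [sub_ne_zero]; exact_mod_cast fun h => hij (Fin.ext h))
    exact_mod_cast this
  · change dist (γ _) (γ _) ≤ _
    rw [hdist, abs_sub_le_iff]
    obtain ⟨hi0, hi1⟩ := hmem i
    obtain ⟨hj0, hj1⟩ := hmem j
    constructor <;> linarith

/-- A finite covering number provides a separated family of the same size. -/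
lemma exists_separated_of_localCovering (β₀ : M) (δ : ℝ) {ε : ℝ} (hε : 0 ≤ ε)
    (hfin : localCovering β₀ δ ε ≠ ⊤) :
    ∃ T : Finset M, T.card = (localCovering β₀ δ ε).toNat ∧
      (∀ x ∈ T, ∀ y ∈ T, x ≠ y → ε ≤ dist x y) ∧ ∀ x ∈ T, ∀ y ∈ T, dist x y ≤ 2 * δ := by
  obtain ⟨N, hN⟩ := ENat.ne_top_iff_exists.1 hfin
  have hle : (N : ℕ∞) ≤ Metric.packingNumber ε.toNNReal (Metric.closedBall β₀ δ) :=
    hN.trans_le (Metric.coveringNumber_le_packingNumber _ _)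
  obtain ⟨S, hS, hsep, hNS⟩ : ∃ S ⊆ Metric.closedBall β₀ δ,
      Metric.IsSeparated ε.toNNReal S ∧ (N : ℕ∞) ≤ S.encard := by
    -- The packing number may be infinite or a supremum; in either case some separated set has at
    -- least `N` points, and it is then cut down to exactly `N`.
    by_cases h : Metric.packingNumber ε.toNNReal (Metric.closedBall β₀ δ) = ⊤
    · by_contra! hlt
      have : Metric.packingNumber ε.toNNReal (Metric.closedBall β₀ δ) ≤ N :=
        iSup₂_le fun S hS => iSup_le fun hsep => (hlt S hS hsep).le
      rw [h] at this
      exact absurd this (by simp)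
    · obtain ⟨S, hS, -, hsep, hcard⟩ := Metric.exists_set_encard_eq_packingNumber h
      exact ⟨S, hS, hsep, hcard ▸ hle⟩
  obtain ⟨T, hTS, hT⟩ := Set.exists_subset_encard_eq hNS
  have hTfin : T.Finite := Set.finite_of_encard_eq_coe hT
  refine ⟨hTfin.toFinset, ?_, fun x hx y hy hxy => ?_, fun x hx y hy => ?_⟩
  · rw [hTfin.encard_eq_coe_toFinset_card] at hT
    rw [← hN, ENat.toNat_natCast]
    exact_mod_cast hT
  · have : ENNReal.ofReal ε < edist x y :=
      hsep (hTS (hTfin.mem_toFinset.1 hx)) (hTS (hTfin.mem_toFinset.1 hy)) hxy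
    rw [edist_dist, ENNReal.ofReal_lt_ofReal_iff_of_nonneg hε] at this
    exact this.le
  · have h1 := Metric.mem_closedBall.1 (hS (hTS (hTfin.mem_toFinset.1 hx)))
    have h2 := Metric.mem_closedBall.1 (hS (hTS (hTfin.mem_toFinset.1 hy)))
    linarith [dist_triangle_right x y β₀]

end Families

/-! ### Critical radius and the resulting rates. -/

section Rate

variable {M : Type*} [MetricSpace M] [MeasurableSpace M] {P : Measure M}

/-- The minimax bound of a separated family at the critical radius. -/
lemma rate_le_minimaxRisk [BorelSpace M] [IsProbabilityMeasure P] {C α : ℝ} (hC : 0 < C)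
    (hα : 0 < α) (hproj : ProjectionHolder M C α) {μ : M}
    (hint : Integrable (fun x => dist μ x ^ 2) P) (hvar : 0 < variance P μ)
    (hmeas : ∀ β : M, AEMeasurable (fun x => alexInner β x μ) P)
    {ι : Type*} [Fintype ι] (hcard : 16 ≤ Fintype.card ι) {β : ι → M} {s B : ℝ} (hs : 0 < s)
    (hB : 0 < B) (hlog : 4 * s ≤ Real.log (Fintype.card ι)) {n : ℕ} (hn : 0 < n)
    (hsep : Pairwise fun i j =>
      (s / (C ^ 2 * variance P μ * n)) ^ (1 / (2 * α)) / B ≤ dist (β i) (β j))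
    (hdiam : ∀ i j, dist (β i) (β j) ≤ (s / (C ^ 2 * variance P μ * n)) ^ (1 / (2 * α))) :
    ENNReal.ofReal (1 / (8 * B ^ 2) * (s / (C ^ 2 * variance P μ * n)) ^ (1 / α)) ≤
      minimaxRisk P μ n := by
  have hn' : (0 : ℝ) < n := by exact_mod_cast hn
  -- The radius `ρ = t ^ (1 / (2 * α))` solves `n * (C * ρ ^ α) ^ 2 * variance P μ = s`.
  set t := s / (C ^ 2 * variance P μ * n) with ht
  have ht0 : 0 < t := by positivity
  have hpow : (t ^ (1 / (2 * α))) ^ 2 = t ^ (1 / α) := by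
    rw [← Real.rpow_natCast, ← Real.rpow_mul ht0.le]
    congr 1; push_cast; field_simp
  have hpow' : ((t ^ (1 / (2 * α))) ^ α) ^ 2 = t := by
    rw [← Real.rpow_natCast, ← Real.rpow_mul ht0.le, ← Real.rpow_mul ht0.le]
    convert Real.rpow_one t using 2
    push_cast; field_simp
  have h := le_minimaxRisk hC.le hα.le hproj hint hmeas hcard (ε := t ^ (1 / (2 * α)) / B)
    (by positivity) hsep hdiam (n := n) (by
      rw [mul_pow, hpow', ht]
      have : (n : ℝ) * (C ^ 2 * (s / (C ^ 2 * variance P μ * n)) * variance P μ) = s := by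
        field_simp
      linarith)
  rw [div_pow, hpow] at h
  convert h using 2
  field_simp

lemma eventually_rpow_div_le {s w r p : ℝ} (hp : 0 < p) (hr : 0 < r) :
    ∀ᶠ n : ℕ in atTop, 0 < n ∧ (s / (w * n)) ^ p ≤ r := by
  have h : Tendsto (fun n : ℕ => (s / (w * n)) ^ p) atTop (𝓝 0) := by
    have h1 := (tendsto_const_div_atTop_nhds_zero_nat (s / w)).rpow_const (p := p) (.inr hp.le)
    simpa only [div_div, Real.zero_rpow hp.ne'] using h1
  exact (eventually_gt_atTop 0).and (h.eventually_le_const hr)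

/-- The parametric part of the lower bound: it needs only a nontrivial geodesic. -/
lemma eventually_le_minimaxRisk_of_variance_pos [BorelSpace M] [IsProbabilityMeasure P] {C α : ℝ}
    (hC : 0 < C) (hα : 0 < α) (hM : UniquelyGeodesic M) (hproj : ProjectionHolder M C α) {μ : M}
    (hint : Integrable (fun x => dist μ x ^ 2) P) (hvar : 0 < variance P μ)
    (hmeas : ∀ β : M, AEMeasurable (fun x => alexInner β x μ) P) :
    ∀ᶠ n : ℕ in atTop, ENNReal.ofReal
      (1 / (8 * 16 ^ 2) * ((1 / 2) / (C ^ 2 * variance P μ * n)) ^ (1 / α)) ≤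
        minimaxRisk P μ n := by
  -- Positive variance rules out a one-point space, so there is a nontrivial geodesic.
  obtain ⟨q, hq⟩ : ∃ q : M, 0 < dist μ q := by
    by_contra! h
    have h0 (x : M) : dist μ x = 0 := le_antisymm (h x) dist_nonneg
    simp [variance, h0] at hvar
  filter_upwards [eventually_rpow_div_le (s := 1 / 2) (w := C ^ 2 * variance P μ)
    (p := 1 / (2 * α)) (by positivity) hq] with n ⟨hn, hnq⟩
  obtain ⟨β, hsep, hdiam⟩ := exists_equispaced hM (by positivity) hnq (m := 16) (by norm_num)
  refine rate_le_minimaxRisk hC hα hproj hint hvar hmeas (by simp) (by norm_num) (by norm_num)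
    ?_ hn hsep hdiam
  have h16 : Real.log 16 = 4 * Real.log 2 := by
    rw [← Real.log_rpow two_pos]; norm_num
  have := Real.log_two_gt_d9
  simp only [Fintype.card_fin, Nat.cast_ofNat, h16]
  linarith

/-- The lower bound for a large dimension. -/
lemma eventually_le_minimaxRisk_of_logPolynomialEntropy [BorelSpace M] [IsProbabilityMeasure P]
    {C α : ℝ} (hC : 0 < C) (hα : 0 < α) (hproj : ProjectionHolder M C α) {μ : M}
    (hint : Integrable (fun x => dist μ x ^ 2) P) (hvar : 0 < variance P μ)
    (hmeas : ∀ β : M, AEMeasurable (fun x => alexInner β x μ) P)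
    {β₀ : M} {D a A K : ℝ} (ha : 0 < a) (hD3 : 3 ≤ D) (hDa : -Real.log a ≤ D)
    (hent : LogPolynomialEntropy β₀ D a A K) :
    ∀ᶠ n : ℕ in atTop, ENNReal.ofReal
      (1 / (8 * (2 * max K (Real.exp 2)) ^ 2) *
        ((D / 4) / (C ^ 2 * variance P μ * n)) ^ (1 / α)) ≤ minimaxRisk P μ n := by
  obtain ⟨δ₀, hδ₀, hent⟩ := hent
  have hK0 : 0 < max K (Real.exp 2) := (Real.exp_pos 2).trans_le (le_max_right _ _)
  have hK2 : 2 ≤ Real.log (max K (Real.exp 2)) :=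
    (Real.le_log_iff_exp_le hK0).2 (le_max_right _ _)
  have hKK := le_max_left K (Real.exp 2)
  set K' := max K (Real.exp 2)
  filter_upwards [eventually_rpow_div_le (s := D / 4) (w := C ^ 2 * variance P μ)
    (p := 1 / (2 * α)) (by positivity) hδ₀] with n ⟨hn, hnδ⟩
  have hn' : (0 : ℝ) < n := by exact_mod_cast hn
  have hD0 : 0 < D := by linarith
  have hρ : 0 < (D / 4 / (C ^ 2 * variance P μ * n)) ^ (1 / (2 * α)) := by positivity
  have hrate := @rate_le_minimaxRisk M _ _ P _ _ C α hC hα hproj μ hint hvar hmeas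
  set ρ := (D / 4 / (C ^ 2 * variance P μ * n)) ^ (1 / (2 * α)) with hρdef
  -- The radius `ρ / 2` keeps the diameter at most `ρ`, and the ratio of the radii is the fixed
  -- number `K'`.
  have hratio : ρ / 2 / (ρ / (2 * K')) = K' := by field_simp
  obtain ⟨hfin, hlow, -⟩ := hent (ρ / 2) (ρ / (2 * K')) (by positivity) (by linarith)
    (by positivity) (by rw [hratio]; exact hKK)
  rw [hratio] at hlow
  obtain ⟨T, hT, hsep, hdiam⟩ := exists_separated_of_localCovering β₀ (ρ / 2)
    (ε := ρ / (2 * K')) (by positivity) hfin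
  rw [← hT] at hlow
  -- `log N ≥ log a + D * log K' ≥ -D + 2 * D`; this is why `K'` is at least `exp 2`.
  have hlogT : D ≤ Real.log T.card := by
    have h1 := Real.log_le_log (by positivity) hlow
    rw [Real.log_mul ha.ne' (Real.rpow_pos_of_pos hK0 D).ne', Real.log_rpow hK0] at h1
    nlinarith
  have hTpos : (0 : ℝ) < T.card := lt_of_lt_of_le (by positivity) hlow
  have hT16 : 16 ≤ T.card := by
    have h1 : Real.exp 3 ≤ T.card := (Real.le_log_iff_exp_le hTpos).1 (hD3.trans hlogT)
    have h2 : (16 : ℝ) ≤ Real.exp 3 := by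
      have h3 := Real.exp_one_gt_d9
      have h4 : Real.exp 3 = Real.exp 1 ^ 3 := by rw [← Real.exp_nat_mul]; norm_num
      rw [h4]
      exact le_trans (by norm_num) (pow_le_pow_left₀ (by norm_num) h3.le 3)
    exact_mod_cast h2.trans h1
  refine hrate (ι := T) (by simpa using hT16) (β := Subtype.val) (by positivity)
    (by positivity) (by rw [Fintype.card_coe]; linarith) hn ?_ ?_
  · exact fun i j hij => hsep i i.2 j j.2 (Subtype.coe_injective.ne hij)
  · intro i j
    have := hdiam i i.2 j j.2
    linarith

end Rate

end MetricBinaryRegression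

/-! ### Choice of the constant. -/

theorem mainTheorem2 (C α a A K : ℝ) (hC : 0 < C) (hα : 0 < α) (hα1 : α ≤ 1)
    (ha : 0 < a) (hA : 0 < A) (hK : 0 < K) :
    ∃ c : ℝ, 0 < c ∧
      ∀ (M : Type*) [MetricSpace M] [CompleteSpace M] [MeasurableSpace M] [BorelSpace M],
        UniquelyGeodesic M → ProjectionHolder M C α →
        ∀ (P : Measure M) [IsProbabilityMeasure P] (μ : M), IsFrechetMean P μ →
          Integrable (fun x => dist μ x ^ 2) P → 0 < variance P μ →
          (∀ β : M, AEMeasurable (fun x => alexInner β x μ) P) →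
          ∀ (βstar : M) (D : ℝ), 0 < D →
            (LogPolynomialEntropy βstar D a A K →
              ∀ᶠ n : ℕ in atTop,
                ENNReal.ofReal (c * (D / (variance P μ * n)) ^ (1 / α)) ≤ minimaxRisk P μ n) ∧
            (PolynomialEntropy βstar D a A K →
              ∀ᶠ n : ℕ in atTop,
                ENNReal.ofReal (c * (1 / (variance P μ * n)) ^ (1 / α)) ≤ minimaxRisk P μ n) := by
  -- The threshold depends on `a` alone: from `D₀` on the entropy bound applies, and below it `D` is
  -- replaced by `D₀` in the parametric bound, at the cost of a constant in `c₂`.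
  set D₀ := max 3 (-Real.log a)
  have hD₀ : 0 < D₀ := lt_of_lt_of_le (by norm_num) (le_max_left _ _)
  set K' := max K (Real.exp 2)
  have hK' : 0 < K' := hK.trans_le (le_max_left _ _)
  set c₁ := 1 / (8 * 16 ^ 2) * ((1 / 2) / C ^ 2) ^ (1 / α)
  set c₂ := 1 / (8 * 16 ^ 2) * ((1 / 2) / (D₀ * C ^ 2)) ^ (1 / α)
  set c₃ := 1 / (8 * (2 * K') ^ 2) * ((1 / 4) / C ^ 2) ^ (1 / α)
  refine ⟨min c₁ (min c₂ c₃), by positivity, ?_⟩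
  intro M _ _ _ _ hM hproj P _ μ _ hint hvar hmeas β₀ D hD
  have hpar := eventually_le_minimaxRisk_of_variance_pos hC hα hM hproj hint hvar hmeas
  refine ⟨fun hent => ?_, fun _ => ?_⟩
  · rcases le_or_gt D₀ D with hDD | hDD
    · filter_upwards [eventually_le_minimaxRisk_of_logPolynomialEntropy hC hα hproj hint hvar
        hmeas ha ((le_max_left _ _).trans hDD) ((le_max_right _ _).trans hDD) hent] with n hn
      refine (ENNReal.ofReal_le_ofReal ?_).trans hn
      calc _ ≤ c₃ * (D / (variance P μ * n)) ^ (1 / α) := by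
            gcongr; exact (min_le_right _ _).trans (min_le_right _ _)
        _ = _ := by
            rw [mul_assoc, ← Real.mul_rpow (by positivity) (by positivity), div_mul_div_comm]
            congr 3 <;> ring
    · filter_upwards [hpar] with n hn
      refine (ENNReal.ofReal_le_ofReal ?_).trans hn
      calc _ ≤ c₂ * (D₀ / (variance P μ * n)) ^ (1 / α) := by
            gcongr; exact (min_le_right _ _).trans (min_le_left _ _)
        _ = _ := by
            rw [mul_assoc, ← Real.mul_rpow (by positivity) (by positivity), div_mul_div_comm]
            congr 2
            rw [mul_comm (1 / 2 : ℝ) D₀, mul_assoc D₀, mul_div_mul_left _ _ hD₀.ne',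
              mul_assoc]
  · filter_upwards [hpar] with n hn
    refine (ENNReal.ofReal_le_ofReal ?_).trans hn
    calc _ ≤ c₁ * (1 / (variance P μ * n)) ^ (1 / α) := by
          gcongr; exact min_le_left _ _
      _ = _ := by
          rw [mul_assoc, ← Real.mul_rpow (by positivity) (by positivity), div_mul_div_comm,
            mul_one, mul_assoc]
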